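/- Let $0<m_\Xi<M_\Xi<\infty$, $0<m_\Sigma<M_\Sigma<\infty$, $0<m_{\mathcal H}<M_{\mathcal H}<1$, and consider parameters $\xi\in[m_\Xi,M_\Xi]$, $\sigma\in[m_\Sigma,M_\Sigma]$, $H\in[m_{\mathcal H},M_{\mathcal H}]$. Let $\mu_{\xi,\sigma,H}$ be the stationary distribution of the one-dimensional fractional Ornstein--Uhlenbeck equation $dU_t=-\xi U_t\,dt+\sigma\,dB_t$, i.e. the law of $\bar U_0$ for a stationary solution $\bar U$, where $B$ is a standard fractional Brownian motion with Hurst parameter $H$ (so that $\mathbb E[B_sB_t]=\tfrac12(s^{2H}+t^{2H}-|t-s|^{2H})$). For $p\ge 1$ and probability measures $\mu,\nu$ on $\mathbb R$ with characteristic functions $\hat\mu,\hat\nu$, put $$d_{CF,p}(\mu,\nu)=\Big(\int_{\mathbb R}|\hat\mu(\chi)-\hat\nu(\chi)|^2 g_p(\chi)\,d\chi\Big)^{1/2},\qquad g_p(\chi)=\frac{(1+\chi^2)^{-p}}{\int_{\mathbb R}(1+\eta^2)^{-p}\,d\eta}.$$ Let $\theta$ be one of the three parameters $\xi$, $\sigma$,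 $H$, with range $[m_\Theta,M_\Theta]$, the other two being fixed in their ranges, and write $\mu_\theta$ for the corresponding stationary distribution. If $\theta=H$, assume moreover that $$\xi>\sup_{H\in[m_{\mathcal H},M_{\mathcal H}]}\exp\Big(\frac{\Gamma(2H)+2H\Gamma'(2H)}{2H\,\Gamma(2H)}\Big)\quad\text{or}\quad \xi<\inf_{H\in[m_{\mathcal H},M_{\mathcal H}]}\exp\Big(\frac{\Gamma(2H)+2H\Gamma'(2H)}{2H\,\Gamma(2H)}\Big).$$ Then for every $p\ge1$ there is a constant $c>0$, not depending on $\theta_1,\theta_2$, such that for all $\theta_1,\theta_2\in[m_\Theta,M_\Theta]$, $$d_{CF,p}(\mu_{\theta_1},\mu_{\theta_2})\ge c\,|\theta_1-\theta_2|.$$ In particular strong identifiability holds: there are $c_1>0$ and $\alpha\ge2$ such that $d_{CF,p}(\mu_{\theta},\mu_{\theta_0})^{\alpha}\ge c_1|\theta-\theta_0|^2$ for all $\theta,\theta_0\in[m_\Theta,M_\Theta]$. -/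

import Mathlib

open MeasureTheory ProbabilityTheory Set
open scoped NNReal

noncomputable section

/-- `B` is a (standard, real, continuous) fractional Brownian motion on `[0, ∞)` with Hurst
parameter `H`: a centred Gaussian process with a.s. continuous paths and covariance
`(s ^ (2H) + t ^ (2H) - |s - t| ^ (2H)) / 2`. -/
structure IsFractionalBrownianMotion {Ω : Type*} [MeasurableSpace Ω] (H : ℝ)
    (B : ℝ≥0 → Ω → ℝ) (P : Measure Ω) : Prop where
  isGaussianProcess : IsGaussianProcess B P
  integral_eq_zero : ∀ t, ∫ ω, B t ω ∂P = 0
  covariance_eq : ∀ s t : ℝ≥0, cov[B s, B t; P] =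
    ((s : ℝ) ^ (2 * H) + (t : ℝ) ^ (2 * H) - |(s : ℝ) - (t : ℝ)| ^ (2 * H)) / 2
  continuous_paths : ∀ᵐ ω ∂P, Continuous fun t => B t ω

/-- `U` is a solution on `[0, ∞)` of the fractional Ornstein-Uhlenbeck equation
`dU = -ξ U dt + σ dB`: it has a.s. continuous paths and, almost surely,
`U_t = U_0 - ξ ∫₀ᵗ U_s ds + σ B_t` for all `t ≥ 0`. -/
structure IsFractionalOU {Ω : Type*} [MeasurableSpace Ω] (ξ σ : ℝ)
    (B U : ℝ≥0 → Ω → ℝ) (P : Measure Ω) : Prop where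
  continuous_paths : ∀ᵐ ω ∂P, Continuous fun t => U t ω
  equation : ∀ᵐ ω ∂P, ∀ t : ℝ≥0,
    U t ω = U 0 ω - ξ * (∫ s in (0 : ℝ)..(t : ℝ), U s.toNNReal ω) + σ * B t ω

/-- `U` is a stationary process: its finite-dimensional distributions are invariant under
time shifts. -/
def IsStationaryProcess {Ω : Type*} [MeasurableSpace Ω]
    (U : ℝ≥0 → Ω → ℝ) (P : Measure Ω) : Prop :=
  ∀ (h : ℝ≥0) (I : Finset ℝ≥0),
    IdentDistrib (fun ω (i : I) => U (i + h) ω) (fun ω (i : I) => U i ω) P P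

/-- `μ` is the stationary distribution of the fractional Ornstein-Uhlenbeck process with
parameters `(ξ, σ, H)`: the one-time marginal law of a stationary solution driven by some
fractional Brownian motion of Hurst parameter `H`. -/
def IsStationaryLawFOU (ξ σ H : ℝ) (μ : Measure ℝ) : Prop :=
  ∃ (Ω : Type) (_ : MeasurableSpace Ω) (P : Measure Ω) (B U : ℝ≥0 → Ω → ℝ),
    IsProbabilityMeasure P ∧ IsFractionalBrownianMotion H B P ∧ IsFractionalOU ξ σ B U P ∧
      IsStationaryProcess U P ∧ P.map (U 0) = μ

/-- The kernel `g_p(χ) = c_p (1 + χ²)^(-p)` on `ℝ`, normalised to have integral one. -/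
def cfKernel (p χ : ℝ) : ℝ :=
  (∫ η : ℝ, (1 + η ^ 2) ^ (-p))⁻¹ * (1 + χ ^ 2) ^ (-p)

/-- The distance `d_{CF,p}` between two laws on `ℝ`. -/
def dCF (p : ℝ) (μ ν : Measure ℝ) : ℝ :=
  Real.sqrt (∫ χ : ℝ, ‖charFun μ χ - charFun ν χ‖ ^ 2 * cfKernel p χ)

/-- For a one-parameter family of laws, indexed by `θ ∈ [m, M]` and given by the relation
`Law θ μ` (`μ` is the law with parameter `θ`): `d_{CF,p}` dominates a multiple of the distance
between the parameters. -/
def LowerLipschitzCF (p m M : ℝ) (Law : ℝ → Measure ℝ → Prop) : Prop :=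
  ∃ c : ℝ, 0 < c ∧ ∀ θ₁ ∈ Icc m M, ∀ θ₂ ∈ Icc m M, ∀ μ₁ μ₂ : Measure ℝ,
    Law θ₁ μ₁ → Law θ₂ μ₂ → c * |θ₁ - θ₂| ≤ dCF p μ₁ μ₂

/-- Strong identifiability of a one-parameter family of laws, for every value `θ₀` of the true
parameter. -/
def StronglyIdentifiableCF (p m M : ℝ) (Law : ℝ → Measure ℝ → Prop) : Prop :=
  ∃ c₁ α : ℝ, 0 < c₁ ∧ 2 ≤ α ∧ ∀ θ₀ ∈ Icc m M, ∀ θ ∈ Icc m M, ∀ μ₀ μ : Measure ℝ,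
    Law θ₀ μ₀ → Law θ μ → c₁ * |θ - θ₀| ^ 2 ≤ dCF p μ μ₀ ^ α

/-- The threshold `exp ((Γ(2H) + 2H Γ'(2H)) / (2H Γ(2H)))`. -/
def hurstThreshold (H : ℝ) : ℝ :=
  Real.exp ((Real.Gamma (2 * H) + 2 * H * deriv Real.Gamma (2 * H)) /
    (2 * H * Real.Gamma (2 * H)))

end

/-! ### Lower bounds for the distance between centred Gaussian laws -/

/-! Every stationary law is the centred Gaussian with variance `v = σ² H Γ(2H) ξ^(-2H)`, so its
characteristic function is `exp (-v χ² / 2)`. On the window `χ ∈ [1, 2]` two such functions differ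
by at least a constant times `|v₁ - v₂|`, as long as the variances stay bounded; hence `d_{CF,p}`
dominates `|v₁ - v₂|` (`exists_mul_abs_sub_le_dCF`). It remains to see that `log v` is strictly
monotone in each parameter with slope bounded away from zero. The slopes are `-2H/ξ`, `2/σ` and `2
(log (hurstThreshold H) - log ξ)`; the assumption on `ξ` fixes the sign of the last one, and
compactness bounds it away from zero (`identifiable_of_logVariance`, `exists_hurst_deriv_bound`).

The law is identified in `charFun_of_isStationaryLawFOU`. The equation is solved path by path
(`linear_equation_solution`) as `U_t = e^(-ξt) (U_0 + σ B_t) + σ ξ ∫₀ᵗ e^(-ξu) (B_t - B_(t-u)) du`.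
The first summand vanishes as `t → ∞`, however `U_0` depends on `B`. The integral is a pathwise
limit of centred Gaussian Riemann sums, and its variance tends to a Gamma integral. By stationarity
`U_t` has the law of `U_0`, so that law is the limiting Gaussian. -/

theorem integrable_one_add_sq_rpow_neg {p : ℝ} (hp : 1 ≤ p) :
    Integrable (fun χ : ℝ => (1 + χ ^ 2) ^ (-p)) := by
  have h := integrable_rpow_neg_one_add_norm_sq (E := ℝ) (μ := volume) (r := 2 * p)
    (by simp; linarith)
  refine h.congr (Filter.Eventually.of_forall fun x => ?_)
  simp only [Real.norm_eq_abs, sq_abs]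
  congr 1
  ring

theorem integral_one_add_sq_rpow_neg_pos {p : ℝ} (hp : 1 ≤ p) :
    0 < ∫ χ : ℝ, (1 + χ ^ 2) ^ (-p) := by
  rw [integral_pos_iff_support_of_nonneg (fun χ => by positivity)
    (integrable_one_add_sq_rpow_neg hp)]
  have : Function.support (fun χ : ℝ => (1 + χ ^ 2) ^ (-p)) = univ :=
    Function.support_eq_univ fun χ => (by positivity : (0 : ℝ) < (1 + χ ^ 2) ^ (-p)).ne'
  simp [this]

theorem cfKernel_nonneg (p χ : ℝ) : 0 ≤ cfKernel p χ := by
  unfold cfKernel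
  have : 0 ≤ ∫ η : ℝ, (1 + η ^ 2) ^ (-p) := integral_nonneg fun η => by positivity
  positivity

theorem integrable_cfKernel {p : ℝ} (hp : 1 ≤ p) : Integrable (cfKernel p) :=
  (integrable_one_add_sq_rpow_neg hp).const_mul _

theorem exp_sub_exp_ge {x y z : ℝ} (hxy : x ≤ y) (hz : z ≤ x) :
    Real.exp z * (y - x) ≤ Real.exp y - Real.exp x := by
  have h1 := Real.add_one_le_exp (y - x)
  have h2 : Real.exp y = Real.exp x * Real.exp (y - x) := by rw [← Real.exp_add]; congr 1; ring
  have h3 := Real.exp_le_exp.2 hz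
  have h4 := Real.exp_pos x
  rw [h2]
  nlinarith

theorem exp_mul_abs_sub_le {x y z : ℝ} (hx : z ≤ x) (hy : z ≤ y) :
    Real.exp z * |x - y| ≤ |Real.exp x - Real.exp y| := by
  rcases le_total x y with h | h
  · rw [abs_sub_comm, abs_sub_comm (Real.exp x), abs_of_nonneg (sub_nonneg.2 h)]
    exact (exp_sub_exp_ge h hx).trans (le_abs_self _)
  · rw [abs_of_nonneg (sub_nonneg.2 h)]
    exact (exp_sub_exp_ge h hy).trans (le_abs_self _)

theorem exists_mul_abs_sub_le_dCF {p : ℝ} (hp : 1 ≤ p) (b : ℝ) :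
    ∃ c : ℝ, 0 < c ∧ ∀ v₁ ∈ Icc 0 b, ∀ v₂ ∈ Icc 0 b, ∀ μ₁ μ₂ : Measure ℝ,
      (∀ χ : ℝ, charFun μ₁ χ = (Real.exp (-(v₁ * χ ^ 2 / 2)) : ℝ)) →
      (∀ χ : ℝ, charFun μ₂ χ = (Real.exp (-(v₂ * χ ^ 2 / 2)) : ℝ)) →
      c * |v₁ - v₂| ≤ dCF p μ₁ μ₂ := by
  have hZ := integral_one_add_sq_rpow_neg_pos hp
  set Z := ∫ χ : ℝ, (1 + χ ^ 2) ^ (-p) with hZdef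
  set k : ℝ := Z⁻¹ * 5 ^ (-p) with hk
  have hk0 : 0 < k := by positivity
  -- For `1 ≤ χ ≤ 2` both exponents lie above `-2b`, so `exp` has slope at least `exp (-2b)` there;
  -- the factor `1/2` is the minimum of `χ²/2`, and `k` is the kernel at `χ = 2`. The window has
  -- length one, so no further factor appears.
  refine ⟨Real.exp (-(2 * b)) / 2 * √k, by positivity, ?_⟩
  intro v₁ hv₁ v₂ hv₂ μ₁ μ₂ h₁ h₂
  unfold dCF
  apply Real.le_sqrt_of_sq_le
  have hnorm : ∀ χ : ℝ, ‖charFun μ₁ χ - charFun μ₂ χ‖ =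
      |Real.exp (-(v₁ * χ ^ 2 / 2)) - Real.exp (-(v₂ * χ ^ 2 / 2))| := fun χ => by
    rw [h₁, h₂, ← Complex.ofReal_sub, Complex.norm_real, Real.norm_eq_abs]
  simp_rw [hnorm, sq_abs]
  set F : ℝ → ℝ := fun χ =>
    (Real.exp (-(v₁ * χ ^ 2 / 2)) - Real.exp (-(v₂ * χ ^ 2 / 2))) ^ 2 * cfKernel p χ with hF
  have hF0 : ∀ χ, 0 ≤ F χ := fun χ => mul_nonneg (sq_nonneg _) (cfKernel_nonneg p χ)
  have hFi : Integrable F := by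
    refine (integrable_cfKernel hp).bdd_mul (c := 1)
      (Continuous.aestronglyMeasurable (by fun_prop)) (Filter.Eventually.of_forall fun χ => ?_)
    have e1 : Real.exp (-(v₁ * χ ^ 2 / 2)) ≤ 1 := by
      rw [Real.exp_le_one_iff]
      have := mul_nonneg hv₁.1 (sq_nonneg χ)
      linarith
    have e2 : Real.exp (-(v₂ * χ ^ 2 / 2)) ≤ 1 := by
      rw [Real.exp_le_one_iff]
      have := mul_nonneg hv₂.1 (sq_nonneg χ)
      linarith
    have e3 := Real.exp_pos (-(v₁ * χ ^ 2 / 2))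
    have e4 := Real.exp_pos (-(v₂ * χ ^ 2 / 2))
    rw [Real.norm_eq_abs, abs_of_nonneg (sq_nonneg _), sq_le_one_iff_abs_le_one, abs_le]
    constructor <;> linarith
  have hlow : ∀ χ ∈ Icc (1 : ℝ) 2, (Real.exp (-(2 * b)) / 2 * √k * |v₁ - v₂|) ^ 2 ≤ F χ := by
    intro χ hχ
    have hχ1 : 1 ≤ χ ^ 2 := by nlinarith [hχ.1]
    have hχ2 : χ ^ 2 ≤ 4 := by nlinarith [hχ.1, hχ.2]
    have hker : k ≤ cfKernel p χ := by
      unfold cfKernel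
      rw [hk, ← hZdef]
      refine mul_le_mul_of_nonneg_left ?_ (by positivity)
      exact Real.rpow_le_rpow_of_nonpos (by positivity) (by linarith) (by linarith)
    have hdiff : Real.exp (-(2 * b)) / 2 * |v₁ - v₂| ≤
        |Real.exp (-(v₁ * χ ^ 2 / 2)) - Real.exp (-(v₂ * χ ^ 2 / 2))| := by
      have hb : ∀ v ∈ Icc 0 b, -(2 * b) ≤ -(v * χ ^ 2 / 2) := fun v hv => by
        nlinarith [hv.1, hv.2]
      refine le_trans ?_ (exp_mul_abs_sub_le (hb _ hv₁) (hb _ hv₂))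
      rw [show -(v₁ * χ ^ 2 / 2) - -(v₂ * χ ^ 2 / 2) = -((v₁ - v₂) * (χ ^ 2 / 2)) by ring,
        abs_neg, abs_mul, abs_of_nonneg (show 0 ≤ χ ^ 2 / 2 by positivity), div_mul_eq_mul_div,
        mul_div_assoc]
      refine mul_le_mul_of_nonneg_left ?_ (Real.exp_pos _).le
      have := abs_nonneg (v₁ - v₂)
      nlinarith
    rw [mul_right_comm, mul_pow, Real.sq_sqrt hk0.le, hF]
    refine mul_le_mul ?_ hker hk0.le (sq_nonneg _)
    rw [← sq_abs (Real.exp _ - _)]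
    exact pow_le_pow_left₀ (by positivity) hdiff 2
  calc (Real.exp (-(2 * b)) / 2 * √k * |v₁ - v₂|) ^ 2
      = ∫ _ in Icc (1 : ℝ) 2, (Real.exp (-(2 * b)) / 2 * √k * |v₁ - v₂|) ^ 2 := by
        rw [setIntegral_const]
        simp [Measure.real]
        norm_num
    _ ≤ ∫ χ in Icc (1 : ℝ) 2, F χ :=
        setIntegral_mono_on (integrableOn_const (by simp)) hFi.integrableOn measurableSet_Icc hlow
    _ ≤ ∫ χ, F χ := setIntegral_le_integral hFi (Filter.Eventually.of_forall hF0)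

/-! ### From the variance to the parameter. -/

theorem LowerLipschitzCF.stronglyIdentifiableCF {p m M : ℝ} {Law : ℝ → Measure ℝ → Prop}
    (h : LowerLipschitzCF p m M Law) : StronglyIdentifiableCF p m M Law := by
  obtain ⟨c, hc, H⟩ := h
  refine ⟨c ^ 2, 2, by positivity, le_rfl, fun θ₀ h₀ θ hθ μ₀ μ hμ₀ hμ => ?_⟩
  have := H θ hθ θ₀ h₀ μ μ₀ hμ hμ₀
  rw [Real.rpow_two, ← mul_pow]
  exact pow_le_pow_left₀ (by positivity) this 2

theorem mul_abs_sub_le_of_le_deriv {L L' : ℝ → ℝ} {m M κ : ℝ}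
    (hL : ∀ x ∈ Icc m M, HasDerivAt L (L' x) x)
    (h : (∀ x ∈ Icc m M, κ ≤ L' x) ∨ ∀ x ∈ Icc m M, L' x ≤ -κ) :
    ∀ x ∈ Icc m M, ∀ y ∈ Icc m M, κ * |x - y| ≤ |L x - L y| := by
  have key : ∀ f f' : ℝ → ℝ, (∀ x ∈ Icc m M, HasDerivAt f (f' x) x) →
      (∀ x ∈ Icc m M, κ ≤ f' x) → ∀ x ∈ Icc m M, ∀ y ∈ Icc m M, κ * |x - y| ≤ |f x - f y| := by
    intro f f' hf hle
    have mono : ∀ x ∈ Icc m M, ∀ y ∈ Icc m M, x ≤ y → κ * (y - x) ≤ f y - f x :=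
      (convex_Icc m M).mul_sub_le_image_sub_of_le_deriv
        (fun x hx => (hf x hx).continuousAt.continuousWithinAt)
        (fun x hx => (hf x (interior_subset hx)).differentiableAt.differentiableWithinAt)
        (fun x hx => by
          rw [(hf x (interior_subset hx)).deriv]
          exact hle x (interior_subset hx))
    intro x hx y hy
    rcases le_total x y with hxy | hxy
    · rw [abs_sub_comm, abs_sub_comm (f x), abs_of_nonneg (sub_nonneg.2 hxy)]
      exact (mono x hx y hy hxy).trans (le_abs_self _)
    · rw [abs_of_nonneg (sub_nonneg.2 hxy)]
      exact (mono y hy x hx hxy).trans (le_abs_self _)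
  rcases h with h | h
  · exact key L L' hL h
  · intro x hx y hy
    have := key (fun z => -L z) (fun z => -L' z) (fun z hz => (hL z hz).neg)
      (fun z hz => by linarith [h z hz]) x hx y hy
    rwa [← neg_sub', abs_neg] at this

/-- A family of centred Gaussian laws is strongly identifiable as soon as the derivative of the
logarithm of its variance is bounded away from zero, with a constant sign. -/
theorem identifiable_of_logVariance {p m M : ℝ} (hp : 1 ≤ p)
    {Law : ℝ → Measure ℝ → Prop} {L L' : ℝ → ℝ} {κ : ℝ} (hκ : 0 < κ)
    (hLaw : ∀ θ ∈ Icc m M, ∀ μ, Law θ μ →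
      ∀ χ : ℝ, charFun μ χ = (Real.exp (-(Real.exp (L θ) * χ ^ 2 / 2)) : ℝ))
    (hL : ∀ x ∈ Icc m M, HasDerivAt L (L' x) x)
    (h : (∀ x ∈ Icc m M, κ ≤ L' x) ∨ ∀ x ∈ Icc m M, L' x ≤ -κ) :
    LowerLipschitzCF p m M Law ∧ StronglyIdentifiableCF p m M Law := by
  suffices hs : LowerLipschitzCF p m M Law from ⟨hs, hs.stronglyIdentifiableCF⟩
  have hcomp : IsCompact (L '' Icc m M) := isCompact_Icc.image_of_continuousOn
    fun x hx => (hL x hx).continuousAt.continuousWithinAt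
  obtain ⟨a, ha⟩ := hcomp.bddBelow
  obtain ⟨b, hb⟩ := hcomp.bddAbove
  have ha' : ∀ x ∈ Icc m M, a ≤ L x := fun x hx => ha (mem_image_of_mem L hx)
  have hb' : ∀ x ∈ Icc m M, L x ≤ b := fun x hx => hb (mem_image_of_mem L hx)
  obtain ⟨c, hc, hd⟩ := exists_mul_abs_sub_le_dCF hp (Real.exp b)
  have hv : ∀ x ∈ Icc m M, Real.exp (L x) ∈ Icc 0 (Real.exp b) := fun x hx =>
    ⟨(Real.exp_pos _).le, Real.exp_le_exp.2 (hb' x hx)⟩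
  -- `κ` passes from parameters to log-variances, `exp a` from log-variances to variances, and `c`
  -- from variances to the distance.
  refine ⟨c * (Real.exp a * κ), by positivity, fun θ₁ h₁ θ₂ h₂ μ₁ μ₂ hμ₁ hμ₂ => ?_⟩
  refine le_trans ?_ (hd _ (hv _ h₁) _ (hv _ h₂) μ₁ μ₂ (hLaw _ h₁ _ hμ₁) (hLaw _ h₂ _ hμ₂))
  rw [mul_assoc, mul_assoc]
  refine mul_le_mul_of_nonneg_left ?_ hc.le
  exact (mul_le_mul_of_nonneg_left (mul_abs_sub_le_of_le_deriv hL h θ₁ h₁ θ₂ h₂)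
    (Real.exp_pos a).le).trans (exp_mul_abs_sub_le (ha' _ h₁) (ha' _ h₂))

/-! ### The variance of the stationary law as a function of the parameters -/

/-- The logarithm of `σ² H Γ(2H) ξ^(-2H)`. -/
noncomputable def logVarianceFOU (ξ σ H : ℝ) : ℝ :=
  2 * Real.log σ + Real.log (H * Real.Gamma (2 * H)) - 2 * H * Real.log ξ

theorem exp_logVarianceFOU {ξ σ H : ℝ} (hξ : 0 < ξ) (hσ : 0 < σ) (hH : 0 < H) :
    Real.exp (logVarianceFOU ξ σ H) = σ ^ 2 * (H * Real.Gamma (2 * H) * ξ ^ (-(2 * H))) := by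
  have hG : 0 < H * Real.Gamma (2 * H) := mul_pos hH (Real.Gamma_pos_of_pos (by linarith))
  rw [logVarianceFOU, sub_eq_add_neg, Real.exp_add, Real.exp_add, Real.exp_log hG,
    Real.rpow_def_of_pos hξ, two_mul (Real.log σ), Real.exp_add, Real.exp_log hσ]
  rw [show -(2 * H * Real.log ξ) = Real.log ξ * -(2 * H) by ring]
  ring

theorem hasDerivAt_logVarianceFOU_drift {ξ σ H : ℝ} (hξ : 0 < ξ) :
    HasDerivAt (fun ξ => logVarianceFOU ξ σ H) (-(2 * H * ξ⁻¹)) ξ := by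
  unfold logVarianceFOU
  exact ((Real.hasDerivAt_log hξ.ne').const_mul (2 * H)).const_sub _

theorem hasDerivAt_logVarianceFOU_diffusion {ξ σ H : ℝ} (hσ : 0 < σ) :
    HasDerivAt (fun σ => logVarianceFOU ξ σ H) (2 * σ⁻¹) σ := by
  unfold logVarianceFOU
  exact (((Real.hasDerivAt_log hσ.ne').const_mul 2).add_const _).sub_const _

/-- The derivative is `1/H + 2 Γ'(2H)/Γ(2H) - 2 log ξ`: the threshold is the value of `ξ` at which
the variance is stationary in `H`. -/
theorem hasDerivAt_logVarianceFOU_hurst {ξ σ H : ℝ} (hH : 0 < H) :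
    HasDerivAt (fun H => logVarianceFOU ξ σ H)
      (2 * (Real.log (hurstThreshold H) - Real.log ξ)) H := by
  have hG : 0 < Real.Gamma (2 * H) := Real.Gamma_pos_of_pos (by linarith)
  have hd : HasDerivAt Real.Gamma (deriv Real.Gamma (2 * H)) (2 * H) :=
    (Real.differentiableOn_Gamma_Ioi.differentiableAt
      (Ioi_mem_nhds (by linarith : 0 < 2 * H))).hasDerivAt
  have h2 : HasDerivAt (fun H : ℝ => 2 * H) 2 H := by
    simpa using (hasDerivAt_id H).const_mul (2 : ℝ)
  have h3 : HasDerivAt (fun H => Real.Gamma (2 * H)) (deriv Real.Gamma (2 * H) * 2) H :=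
    hd.comp H h2
  have h4 := ((hasDerivAt_id' H).mul h3 |>.congr_of_eventuallyEq (f₁ := fun H => H * Real.Gamma (2 * H))
    (Filter.Eventually.of_forall fun _ => rfl)).log (mul_pos hH hG).ne'
  have h5 := (h4.const_add (2 * Real.log σ)).sub (h2.mul_const (Real.log ξ))
  unfold logVarianceFOU
  refine h5.congr_deriv ?_
  rw [hurstThreshold, Real.log_exp]
  field_simp

/-- The complex Gamma function is holomorphic on the right half-plane, so its derivative is too; the
real derivative is its restriction. -/
theorem continuousOn_deriv_Gamma : ContinuousOn (deriv Real.Gamma) (Ioi 0) := by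
  have hdiff : DifferentiableOn ℂ Complex.Gamma {z : ℂ | 0 < z.re} := fun z hz =>
    (Complex.differentiableAt_Gamma z fun m hm => by
      have := congrArg Complex.re hm
      simp only [Complex.neg_re, Complex.natCast_re] at this
      have h0 : (0 : ℝ) ≤ m := Nat.cast_nonneg m
      simp only [mem_ofPred_eq] at hz
      linarith).differentiableWithinAt
  have hopen : IsOpen {z : ℂ | 0 < z.re} := isOpen_lt continuous_const Complex.continuous_re
  have hcont : ContinuousOn (deriv Complex.Gamma) {z : ℂ | 0 < z.re} :=
    (hdiff.deriv hopen).continuousOn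
  have heq : EqOn (deriv Real.Gamma) (fun x : ℝ => (deriv Complex.Gamma (x : ℂ)).re) (Ioi 0) := by
    intro x hx
    have hx' : (x : ℂ) ∈ {z : ℂ | 0 < z.re} := by simpa using hx
    have hc := ((hdiff _ hx').differentiableAt (hopen.mem_nhds hx')).hasDerivAt
    have := hc.real_of_complex
    simp only [Complex.Gamma_ofReal, Complex.ofReal_re] at this
    exact this.deriv
  refine ContinuousOn.congr ?_ heq
  exact Complex.continuous_re.comp_continuousOn
    (hcont.comp Complex.continuous_ofReal.continuousOn fun x hx => by simpa using hx)

theorem continuousOn_hurstThreshold {m M : ℝ} (hm : 0 < m) :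
    ContinuousOn hurstThreshold (Icc m M) := by
  have hmaps : MapsTo (fun H : ℝ => 2 * H) (Icc m M) (Ioi 0) := fun H hH => by
    have := hH.1
    simp only [mem_Ioi]
    linarith
  have h2 : ContinuousOn (fun H : ℝ => 2 * H) (Icc m M) := by fun_prop
  have hG : ContinuousOn (fun H => Real.Gamma (2 * H)) (Icc m M) :=
    Real.differentiableOn_Gamma_Ioi.continuousOn.comp h2 hmaps
  have hG' : ContinuousOn (fun H => deriv Real.Gamma (2 * H)) (Icc m M) :=
    continuousOn_deriv_Gamma.comp h2 hmaps
  unfold hurstThreshold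
  refine Real.continuous_exp.comp_continuousOn ((hG.add (h2.mul hG')).div (h2.mul hG) ?_)
  intro H hH
  have hpos : 0 < 2 * H := hmaps hH
  exact (mul_pos hpos (Real.Gamma_pos_of_pos hpos)).ne'

theorem exists_hurst_deriv_bound {m M ξ : ℝ} (hm : 0 < m) (hmM : m ≤ M) (hξ : 0 < ξ)
    (h : sSup (hurstThreshold '' Icc m M) < ξ ∨ ξ < sInf (hurstThreshold '' Icc m M)) :
    ∃ κ : ℝ, 0 < κ ∧
      ((∀ H ∈ Icc m M, κ ≤ 2 * (Real.log (hurstThreshold H) - Real.log ξ)) ∨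
        ∀ H ∈ Icc m M, 2 * (Real.log (hurstThreshold H) - Real.log ξ) ≤ -κ) := by
  -- Compactness makes `sSup` a true upper bound rather than the default value of an unbounded set.
  have hcomp : IsCompact (hurstThreshold '' Icc m M) :=
    isCompact_Icc.image_of_continuousOn (continuousOn_hurstThreshold hm)
  have hpos : ∀ H, 0 < hurstThreshold H := fun H => Real.exp_pos _
  rcases h with h | h
  · set S := sSup (hurstThreshold '' Icc m M)
    have hle : ∀ H ∈ Icc m M, hurstThreshold H ≤ S := fun H hH =>
      le_csSup hcomp.bddAbove (mem_image_of_mem _ hH)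
    have hS : 0 < S := (hpos m).trans_le (hle m ⟨le_rfl, hmM⟩)
    refine ⟨2 * (Real.log ξ - Real.log S), ?_, Or.inr fun H hH => ?_⟩
    · linarith [Real.log_lt_log hS h]
    · linarith [Real.log_le_log (hpos H) (hle H hH)]
  · set S := sInf (hurstThreshold '' Icc m M)
    have hle : ∀ H ∈ Icc m M, S ≤ hurstThreshold H := fun H hH =>
      csInf_le hcomp.bddBelow (mem_image_of_mem _ hH)
    refine ⟨2 * (Real.log S - Real.log ξ), ?_, Or.inl fun H hH => ?_⟩
    · linarith [Real.log_lt_log hξ h]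
    · linarith [Real.log_le_log (hξ.trans h) (hle H hH)]

/-! ### Riemann sums -/

-- A Riemann sum is the integral of a step function, which turns convergence of Riemann sums into
-- dominated convergence.
open Filter Topology in
theorem sum_div_eq_integral_floor (g : ℝ → ℝ) (n : ℕ) (hn : 0 < n) :
    IntervalIntegrable (fun s : ℝ => g ((⌊n * s⌋₊ : ℝ) / n)) volume 0 1 ∧
    ∫ s in (0 : ℝ)..1, g ((⌊n * s⌋₊ : ℝ) / n) = (∑ k ∈ Finset.range n, g (k / n)) / n := by
  have hn' : (0 : ℝ) < n := by exact_mod_cast hn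
  set a : ℕ → ℝ := fun k => k / n with ha
  have hle : ∀ k, a k ≤ a (k + 1) := fun k => by
    simp only [ha]; gcongr; simp
  have hae : ∀ k : ℕ, ∀ᵐ s : ℝ ∂volume.restrict (Ioc (a k) (a (k + 1))),
      g (k / n) = g ((⌊n * s⌋₊ : ℝ) / n) := by
    intro k
    -- The right endpoint, where the floor jumps to `k + 1`, is a null set.
    rw [← restrict_Ioo_eq_restrict_Ioc]
    refine (ae_restrict_iff' measurableSet_Ioo).2 (Eventually.of_forall fun s hs => ?_)
    have h1 : (k : ℝ) < n * s := by
      have := hs.1; simp only [ha] at this; rwa [div_lt_iff₀' hn'] at this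
    have h2 : n * s < (k : ℝ) + 1 := by
      have := hs.2; simp only [ha] at this; rw [lt_div_iff₀' hn'] at this; push_cast at this
      exact this
    have : ⌊n * s⌋₊ = k := (Nat.floor_eq_iff ((Nat.cast_nonneg k).trans h1.le)).2 ⟨h1.le, h2⟩
    rw [this]
  have hint : ∀ k : ℕ, IntervalIntegrable (fun s : ℝ => g ((⌊n * s⌋₊ : ℝ) / n)) volume
      (a k) (a (k + 1)) := fun k => by
    rw [intervalIntegrable_iff_integrableOn_Ioc_of_le (hle k)]
    exact (integrable_const (g (k / n))).congr (hae k)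
  have hval : ∀ k : ℕ, ∫ s in a k..a (k + 1), g ((⌊n * s⌋₊ : ℝ) / n) = g (k / n) / n := fun k => by
    rw [intervalIntegral.integral_of_le (hle k), ← integral_congr_ae (hae k),
      ← intervalIntegral.integral_of_le (hle k), intervalIntegral.integral_const, smul_eq_mul]
    simp only [ha]
    push_cast
    ring
  have h0 : a 0 = 0 := by simp [ha]
  have h1 : a n = 1 := by simp [ha, hn'.ne']
  constructor
  · have := IntervalIntegrable.trans_iterate (n := n) fun k _ => hint k
    rwa [h0, h1] at this
  · have := intervalIntegral.sum_integral_adjacent_intervals (n := n) fun k _ => hint k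
    rw [h0, h1] at this
    rw [← this, Finset.sum_div]
    exact Finset.sum_congr rfl fun k _ => hval k

open Filter Topology in
theorem tendsto_floor_mul_div (s : ℝ) (hs : 0 ≤ s) :
    Tendsto (fun n : ℕ => (⌊n * s⌋₊ : ℝ) / n) atTop (𝓝 s) := by
  have := (tendsto_nat_floor_mul_div_atTop (R := ℝ) hs).comp tendsto_natCast_atTop_atTop
  refine this.congr fun n => ?_
  simp [mul_comm]

theorem floor_mul_div_mem_Icc (n : ℕ) {s : ℝ} (hs : s ∈ Icc (0 : ℝ) 1) :
    (⌊n * s⌋₊ : ℝ) / n ∈ Icc (0 : ℝ) 1 := by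
  refine ⟨by positivity, ?_⟩
  rcases Nat.eq_zero_or_pos n with rfl | hn
  · simp
  have hn' : (0 : ℝ) < n := by exact_mod_cast hn
  rw [div_le_one hn']
  exact (Nat.floor_le (mul_nonneg hn'.le hs.1)).trans (by nlinarith [hs.2])

open Filter Topology in
theorem tendsto_sum_div (g : ℝ → ℝ) (hg : Continuous g) :
    Tendsto (fun n : ℕ => (∑ k ∈ Finset.range n, g (k / n)) / n) atTop
      (𝓝 (∫ s in (0 : ℝ)..1, g s)) := by
  obtain ⟨C, hC⟩ := isCompact_Icc.exists_bound_of_continuousOn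
    (hg.continuousOn (s := Icc (0 : ℝ) 1))
  have hmem : ∀ s ∈ uIoc (0 : ℝ) 1, s ∈ Icc (0 : ℝ) 1 := fun s hs => by
    rw [uIoc_of_le zero_le_one] at hs; exact Ioc_subset_Icc_self hs
  have : Tendsto (fun n : ℕ => ∫ s in (0 : ℝ)..1, g ((⌊n * s⌋₊ : ℝ) / n)) atTop
      (𝓝 (∫ s in (0 : ℝ)..1, g s)) := by
    refine intervalIntegral.tendsto_integral_filter_of_dominated_convergence (fun _ => C) ?_ ?_
      (by simp) ?_
    · refine Eventually.of_forall fun n => Measurable.aestronglyMeasurable ?_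
      exact hg.measurable.comp (by fun_prop)
    · exact Eventually.of_forall fun n => Eventually.of_forall fun s hs =>
        hC _ (floor_mul_div_mem_Icc n (hmem s hs))
    · exact Eventually.of_forall fun s hs =>
        (hg.tendsto s).comp (tendsto_floor_mul_div s (hmem s hs).1)
  refine this.congr' ?_
  filter_upwards [eventually_gt_atTop 0] with n hn
  exact (sum_div_eq_integral_floor g n hn).2

open Filter Topology in
theorem tendsto_sum_sum_div (G : ℝ → ℝ → ℝ) (hG : Continuous (Function.uncurry G)) :
    Tendsto (fun n : ℕ => (∑ k ∈ Finset.range n, (∑ l ∈ Finset.range n, G (k / n) (l / n)) / n) / n)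
      atTop (𝓝 (∫ s in (0 : ℝ)..1, ∫ r in (0 : ℝ)..1, G s r)) := by
  obtain ⟨C, hC⟩ := (isCompact_Icc.prod isCompact_Icc).exists_bound_of_continuousOn
    (hG.continuousOn (s := Icc (0 : ℝ) 1 ×ˢ Icc (0 : ℝ) 1))
  have hmem : ∀ s ∈ uIoc (0 : ℝ) 1, s ∈ Icc (0 : ℝ) 1 := fun s hs => by
    rw [uIoc_of_le zero_le_one] at hs; exact Ioc_subset_Icc_self hs
  set τ : ℕ → ℝ → ℝ := fun n s => (⌊n * s⌋₊ : ℝ) / n with hτ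
  have hτm : ∀ n, Measurable (τ n) := fun n => by simp only [hτ]; fun_prop
  have hcont1 : ∀ r, Continuous fun s => G s r := fun r =>
    hG.comp (Continuous.prodMk continuous_id continuous_const)
  have hcont2 : ∀ s, Continuous fun r => G s r := fun s =>
    hG.comp (Continuous.prodMk continuous_const continuous_id)
  have hinner : ∀ n : ℕ, 0 < n → ∀ x : ℝ,
      ∫ r in (0 : ℝ)..1, G x (τ n r) = (∑ l ∈ Finset.range n, G x (l / n)) / n := fun n hn x =>
    (sum_div_eq_integral_floor (G x) n hn).2
  have : Tendsto (fun n : ℕ => ∫ s in (0 : ℝ)..1, ∫ r in (0 : ℝ)..1, G (τ n s) (τ n r)) atTop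
      (𝓝 (∫ s in (0 : ℝ)..1, ∫ r in (0 : ℝ)..1, G s r)) := by
    refine intervalIntegral.tendsto_integral_filter_of_dominated_convergence (fun _ => C) ?_ ?_
      (by simp) ?_
    · filter_upwards [eventually_gt_atTop 0] with n hn
      simp_rw [hinner n hn]
      refine Measurable.aestronglyMeasurable (Measurable.div_const ?_ _)
      exact Finset.measurable_sum _ fun l _ => (hcont1 _).measurable.comp (hτm n)
    · refine Eventually.of_forall fun n => Eventually.of_forall fun s hs => ?_
      have := intervalIntegral.norm_integral_le_of_norm_le_const (a := (0 : ℝ)) (b := 1) (C := C)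
        (f := fun r => G (τ n s) (τ n r)) fun r hr =>
          hC (τ n s, τ n r) ⟨floor_mul_div_mem_Icc n (hmem s hs), floor_mul_div_mem_Icc n (hmem r hr)⟩
      simpa using this
    · refine Eventually.of_forall fun s hs => ?_
      refine intervalIntegral.tendsto_integral_filter_of_dominated_convergence (fun _ => C) ?_ ?_
        (by simp) ?_
      · exact Eventually.of_forall fun n =>
          ((hcont2 _).measurable.comp (hτm n)).aestronglyMeasurable
      · exact Eventually.of_forall fun n => Eventually.of_forall fun r hr =>
          hC (τ n s, τ n r) ⟨floor_mul_div_mem_Icc n (hmem s hs), floor_mul_div_mem_Icc n (hmem r hr)⟩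
      · refine Eventually.of_forall fun r hr => ?_
        exact (hG.tendsto (s, r)).comp ((tendsto_floor_mul_div s (hmem s hs).1).prodMk_nhds
          (tendsto_floor_mul_div r (hmem r hr).1))
  refine this.congr' ?_
  filter_upwards [eventually_gt_atTop 0] with n hn
  simp_rw [hinner n hn]
  exact (sum_div_eq_integral_floor (fun x => (∑ l ∈ Finset.range n, G x (l / n)) / n) n hn).2

/-! ### The linear equation -/

/-- The primitive `Y` of `y` solves `Y' + ξ Y = y 0 + σ b`, so the integrating factor `exp (ξ s)`
gives `Y` as an ordinary integral of `b`. Putting this back into the equation avoids any integral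
against `db`. -/
theorem linear_equation_solution {ξ σ : ℝ} {y b : ℝ → ℝ} (hy : Continuous y)
    (hb : Continuous b)
    (h : ∀ t, 0 ≤ t → y t = y 0 - ξ * (∫ s in (0 : ℝ)..t, y s) + σ * b t) {t : ℝ} (ht : 0 ≤ t) :
    y t = Real.exp (-(ξ * t)) * (y 0 + σ * b t) +
      σ * ξ * ∫ u in (0 : ℝ)..t, Real.exp (-(ξ * u)) * (b t - b (t - u)) := by
  set Y : ℝ → ℝ := fun t => ∫ s in (0 : ℝ)..t, y s with hY
  have hYd : ∀ s, HasDerivAt Y (y s) s := fun s => hy.integral_hasStrictDerivAt 0 s |>.hasDerivAt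
  have hed : ∀ c s : ℝ, HasDerivAt (fun s => Real.exp (c * s)) (c * Real.exp (c * s)) s :=
    fun c s => by
      have := ((hasDerivAt_id s).const_mul c).exp
      simp only [id, mul_one] at this
      rwa [mul_comm c (Real.exp _)]
  have h1 : ∫ s in (0 : ℝ)..t, Real.exp (ξ * s) * (y 0 + σ * b s) = Real.exp (ξ * t) * Y t := by
    have := intervalIntegral.integral_eq_sub_of_hasDerivAt (a := 0) (b := t)
      (f := fun s => Real.exp (ξ * s) * Y s) (f' := fun s => Real.exp (ξ * s) * (y 0 + σ * b s))
      (fun s hs => by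
        rw [uIcc_of_le ht] at hs
        refine ((hed ξ s).mul (hYd s)).congr_deriv ?_
        rw [h s hs.1]
        ring) (Continuous.intervalIntegrable (by fun_prop) _ _)
    rw [this]
    simp [hY]
  have h2 : ∫ s in (0 : ℝ)..t, Real.exp (-(ξ * s)) * (y 0 + σ * b (t - s)) = Y t := by
    have e : ∫ s in (0 : ℝ)..t, Real.exp (-(ξ * s)) * (y 0 + σ * b (t - s)) =
        ∫ s in (0 : ℝ)..t, Real.exp (-(ξ * t)) * (Real.exp (ξ * s) * (y 0 + σ * b s)) := by
      have := intervalIntegral.integral_comp_sub_left (a := 0) (b := t)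
        (fun s => Real.exp (-(ξ * t)) * (Real.exp (ξ * s) * (y 0 + σ * b s))) t
      rw [sub_self, sub_zero] at this
      rw [← this]
      congr 1
      ext s
      rw [← mul_assoc, ← Real.exp_add]
      congr 2
      ring
    rw [e, intervalIntegral.integral_const_mul, h1, ← mul_assoc, ← Real.exp_add]
    simp
  have h3 : ξ * ∫ u in (0 : ℝ)..t, Real.exp (-(ξ * u)) = 1 - Real.exp (-(ξ * t)) := by
    have := intervalIntegral.integral_eq_sub_of_hasDerivAt (a := 0) (b := t)
      (f := fun s => Real.exp (-ξ * s)) (f' := fun s => -ξ * Real.exp (-ξ * s))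
      (fun s _ => hed (-ξ) s) (Continuous.intervalIntegrable (by fun_prop) _ _)
    rw [intervalIntegral.integral_const_mul] at this
    simp only [neg_mul, mul_zero, Real.exp_zero] at this
    linarith
  have h4 : σ * ∫ u in (0 : ℝ)..t, Real.exp (-(ξ * u)) * (b t - b (t - u)) =
      (y 0 + σ * b t) * (∫ u in (0 : ℝ)..t, Real.exp (-(ξ * u))) - Y t := by
    rw [← h2, ← intervalIntegral.integral_const_mul, ← intervalIntegral.integral_const_mul,
      ← intervalIntegral.integral_sub (Continuous.intervalIntegrable (by fun_prop) _ _)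
        (Continuous.intervalIntegrable (by fun_prop) _ _)]
    congr 1
    ext u
    ring
  have h5 := h t ht
  rw [mul_right_comm, h4, h5]
  linear_combination (-(y 0 + σ * b t)) * h3

/-! ### The stationary variance -/

theorem integrableOn_exp_neg_mul_rpow {ξ a : ℝ} (hξ : 0 < ξ) (ha : 0 < a) :
    IntegrableOn (fun u : ℝ => Real.exp (-(ξ * u)) * u ^ a) (Ioi 0) := by
  have := integrableOn_rpow_mul_exp_neg_mul_rpow (p := 1) (s := a) (by linarith) one_pos hξ
  refine this.congr_fun (fun u _ => ?_) measurableSet_Ioi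
  simp only [Real.rpow_one, neg_mul]
  ring

theorem integral_exp_neg_mul_mul_rpow {ξ a : ℝ} (hξ : 0 < ξ) (ha : 0 < a) :
    ∫ u in Ioi (0 : ℝ), Real.exp (-(ξ * u)) * u ^ a = (1 / ξ) ^ (a + 1) * Real.Gamma (a + 1) := by
  rw [← Real.integral_rpow_mul_exp_neg_mul_Ioi (by linarith) hξ]
  refine integral_congr_ae (Filter.Eventually.of_forall fun u => ?_)
  simp only [add_sub_cancel_right]
  ring

theorem integrableOn_exp_neg_mul_Ioi {ξ : ℝ} (hξ : 0 < ξ) :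
    IntegrableOn (fun u : ℝ => Real.exp (-(ξ * u))) (Ioi 0) := by
  simpa only [neg_mul] using exp_neg_integrableOn_Ioi 0 hξ

theorem integral_exp_neg_mul_Ioi_zero {ξ : ℝ} (hξ : 0 < ξ) :
    ∫ u in Ioi (0 : ℝ), Real.exp (-(ξ * u)) = 1 / ξ := by
  have := integral_exp_mul_Ioi (neg_lt_zero.2 hξ) 0
  simp only [neg_mul, mul_zero, Real.exp_zero] at this
  rw [this, neg_div_neg_eq]

/-- Since `|u - v| ≤ max u v`, no subadditivity of the power is needed; exponents `a = 2H > 1` are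
covered. -/
theorem abs_sub_rpow_le {a u v : ℝ} (ha : 0 < a) (hu : 0 < u) (hv : 0 < v) :
    |u - v| ^ a ≤ u ^ a + v ^ a := by
  have hu' := Real.rpow_nonneg hu.le a
  have hv' := Real.rpow_nonneg hv.le a
  rcases le_total u v with h | h
  · have : |u - v| ^ a ≤ v ^ a :=
      Real.rpow_le_rpow (abs_nonneg _) (by rw [abs_le]; constructor <;> linarith) ha.le
    linarith
  · have : |u - v| ^ a ≤ u ^ a :=
      Real.rpow_le_rpow (abs_nonneg _) (by rw [abs_le]; constructor <;> linarith) ha.le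
    linarith

/-- The measure `dx` on the positive half-line. -/
noncomputable abbrev volumePos : Measure ℝ := volume.restrict (Ioi 0)

theorem integrable_exp_mul_abs_sub_rpow {ξ a : ℝ} (hξ : 0 < ξ) (ha : 0 < a) :
    Integrable (fun z : ℝ × ℝ => Real.exp (-(ξ * z.1)) * Real.exp (-(ξ * z.2)) * |z.1 - z.2| ^ a)
      (volumePos.prod volumePos) := by
  have h1 := (integrableOn_exp_neg_mul_rpow hξ ha).mul_prod (integrableOn_exp_neg_mul_Ioi hξ)
  have h2 := (integrableOn_exp_neg_mul_Ioi hξ).mul_prod (integrableOn_exp_neg_mul_rpow hξ ha)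
  refine (h1.add h2).mono' ?_ ?_
  · refine Continuous.aestronglyMeasurable ?_
    exact Continuous.mul (by fun_prop)
      (Continuous.rpow_const (by fun_prop) fun _ => Or.inr ha.le)
  · rw [Measure.prod_restrict]
    refine (ae_restrict_iff' (measurableSet_Ioi.prod measurableSet_Ioi)).2
      (Filter.Eventually.of_forall fun z hz => ?_)
    rw [Real.norm_eq_abs, abs_of_nonneg (by positivity)]
    have := mul_le_mul_of_nonneg_left (abs_sub_rpow_le ha hz.1 hz.2)
      (by positivity : 0 ≤ Real.exp (-(ξ * z.1)) * Real.exp (-(ξ * z.2)))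
    simp only [Pi.add_apply]
    linarith

/-- The integrand is symmetric and vanishes on the diagonal, so the integral is twice that over `v <
u`. There the shift `u ↦ u + v` separates the variables into a Gamma integral and `∫ exp (-2ξv) dv`.
-/
theorem integral_exp_mul_abs_sub_rpow {ξ a : ℝ} (hξ : 0 < ξ) (ha : 0 < a) :
    ∫ z : ℝ × ℝ, Real.exp (-(ξ * z.1)) * Real.exp (-(ξ * z.2)) * |z.1 - z.2| ^ a
      ∂(volumePos.prod volumePos) = (1 / ξ) ^ (a + 1) * Real.Gamma (a + 1) / ξ := by
  set F : ℝ × ℝ → ℝ := fun z => Real.exp (-(ξ * z.1)) * Real.exp (-(ξ * z.2)) * |z.1 - z.2| ^ a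
    with hF
  set T : Set (ℝ × ℝ) := {z | z.2 < z.1} with hT
  have hTm : MeasurableSet T := measurableSet_lt measurable_snd measurable_fst
  have hFi : Integrable F (volumePos.prod volumePos) := integrable_exp_mul_abs_sub_rpow hξ ha
  have hGi : Integrable (T.indicator F) (volumePos.prod volumePos) := hFi.indicator hTm
  have hsplit : ∀ z, F z = T.indicator F z + T.indicator F z.swap := by
    rintro ⟨u, v⟩
    simp only [indicator, hT, mem_ofPred_eq, Prod.swap, hF]
    rcases lt_trichotomy u v with h | h | h
    · rw [if_neg (not_lt.2 h.le), if_pos h, abs_sub_comm]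
      ring
    · subst h
      simp [ha.ne']
    · rw [if_neg (not_lt.2 h.le), if_pos h]
      ring
  have hinner : ∀ v ∈ Ioi (0 : ℝ), ∫ u in Ioi (0 : ℝ), T.indicator F (u, v) =
      Real.exp (-((2 * ξ) * v)) * ((1 / ξ) ^ (a + 1) * Real.Gamma (a + 1)) := by
    intro v hv
    rw [← integral_exp_neg_mul_mul_rpow hξ ha, ← integral_const_mul, ← integral_indicator measurableSet_Ioi,
      ← integral_indicator measurableSet_Ioi,
      ← integral_add_right_eq_self (indicator (Ioi (0 : ℝ)) _) v]
    congr 1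
    ext u
    simp only [indicator, hT, mem_ofPred_eq, mem_Ioi, hF, lt_add_iff_pos_left,
      add_sub_cancel_right]
    by_cases h : 0 < u
    · rw [if_pos (add_pos h hv), if_pos h, if_pos h, abs_of_pos h, ← mul_assoc,
        ← Real.exp_add, ← Real.exp_add]
      congr 2
      ring
    · simp [h]
  have hG : ∫ z, T.indicator F z ∂(volumePos.prod volumePos) =
      1 / (2 * ξ) * ((1 / ξ) ^ (a + 1) * Real.Gamma (a + 1)) := by
    rw [integral_prod_symm _ hGi, setIntegral_congr_fun measurableSet_Ioi hinner,
      integral_mul_const, integral_exp_neg_mul_Ioi_zero (by linarith)]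
  have hGs : Integrable (fun z => T.indicator F z.swap) (volumePos.prod volumePos) := hGi.swap
  rw [integral_congr_ae (Filter.Eventually.of_forall hsplit), integral_add hGi hGs,
    integral_prod_swap, hG]
  field_simp
  ring

/-- The covariance of the fractional Brownian motion. -/
noncomputable def fbmCov (H u v : ℝ) : ℝ := (u ^ (2 * H) + v ^ (2 * H) - |u - v| ^ (2 * H)) / 2

theorem continuous_fbmCov {H : ℝ} (hH : 0 < H) : Continuous (Function.uncurry (fbmCov H)) := by
  have h2 : 0 ≤ 2 * H := by linarith
  unfold fbmCov Function.uncurry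
  exact (((Continuous.rpow_const (by fun_prop) fun _ => Or.inr h2).add
    (Continuous.rpow_const (by fun_prop) fun _ => Or.inr h2)).sub
    (Continuous.rpow_const (by fun_prop) fun _ => Or.inr h2)).div_const 2

theorem fbmCov_kernel_eq (ξ H : ℝ) (z : ℝ × ℝ) :
    Real.exp (-(ξ * z.1)) * Real.exp (-(ξ * z.2)) * fbmCov H z.1 z.2 =
      2⁻¹ * (Real.exp (-(ξ * z.1)) * z.1 ^ (2 * H) * Real.exp (-(ξ * z.2)) +
        Real.exp (-(ξ * z.1)) * (Real.exp (-(ξ * z.2)) * z.2 ^ (2 * H)) -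
        Real.exp (-(ξ * z.1)) * Real.exp (-(ξ * z.2)) * |z.1 - z.2| ^ (2 * H)) := by
  rw [fbmCov]
  ring

theorem integrable_fbmCov_kernel {ξ H : ℝ} (hξ : 0 < ξ) (hH : 0 < H) :
    Integrable (fun z : ℝ × ℝ => Real.exp (-(ξ * z.1)) * Real.exp (-(ξ * z.2)) * fbmCov H z.1 z.2)
      (volumePos.prod volumePos) := by
  have h2 : 0 < 2 * H := by linarith
  simp_rw [fbmCov_kernel_eq]
  exact ((((integrableOn_exp_neg_mul_rpow hξ h2).mul_prod (integrableOn_exp_neg_mul_Ioi hξ)).add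
    ((integrableOn_exp_neg_mul_Ioi hξ).mul_prod (integrableOn_exp_neg_mul_rpow hξ h2))).sub
    (integrable_exp_mul_abs_sub_rpow hξ h2)).const_mul _

/-- The three terms of the covariance have the same integral `Γ(2H+1) ξ^(-2H-2)`, with signs `+, +,
-`; then `Γ(2H+1) = 2H Γ(2H)`. -/
theorem integral_fbmCov_kernel {ξ H : ℝ} (hξ : 0 < ξ) (hH : 0 < H) :
    ξ ^ 2 * ∫ z : ℝ × ℝ, Real.exp (-(ξ * z.1)) * Real.exp (-(ξ * z.2)) * fbmCov H z.1 z.2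
      ∂(volumePos.prod volumePos) = H * Real.Gamma (2 * H) * ξ ^ (-(2 * H)) := by
  have h2 : 0 < 2 * H := by linarith
  have i1 := (integrableOn_exp_neg_mul_rpow hξ h2).mul_prod (integrableOn_exp_neg_mul_Ioi hξ)
  have i2 := (integrableOn_exp_neg_mul_Ioi hξ).mul_prod (integrableOn_exp_neg_mul_rpow hξ h2)
  have i3 : Integrable (fun z : ℝ × ℝ =>
      Real.exp (-(ξ * z.1)) * z.1 ^ (2 * H) * Real.exp (-(ξ * z.2)) +
        Real.exp (-(ξ * z.1)) * (Real.exp (-(ξ * z.2)) * z.2 ^ (2 * H)))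
      (volumePos.prod volumePos) := i1.add i2
  simp_rw [fbmCov_kernel_eq]
  rw [integral_const_mul, integral_sub i3 (integrable_exp_mul_abs_sub_rpow hξ h2),
    integral_add i1 i2, integral_exp_mul_abs_sub_rpow hξ h2,
    integral_prod_mul (fun u : ℝ => Real.exp (-(ξ * u)) * u ^ (2 * H))
      (fun u : ℝ => Real.exp (-(ξ * u))),
    integral_prod_mul (fun u : ℝ => Real.exp (-(ξ * u)))
      (fun u : ℝ => Real.exp (-(ξ * u)) * u ^ (2 * H)), integral_exp_neg_mul_mul_rpow hξ h2,
    integral_exp_neg_mul_Ioi_zero hξ, Real.Gamma_add_one h2.ne', one_div, Real.inv_rpow hξ.le,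
    Real.rpow_add_one hξ.ne', Real.rpow_neg hξ.le]
  have := (Real.rpow_pos_of_pos hξ (2 * H)).ne'
  field_simp
  ring

/-- The variance of `ξ ∫₀ᵗ exp (-ξ u) (B t - B (t - u)) du`. -/
noncomputable def truncatedVariance (ξ H t : ℝ) : ℝ :=
  ξ ^ 2 * ∫ u in (0 : ℝ)..t, ∫ v in (0 : ℝ)..t,
    Real.exp (-(ξ * u)) * Real.exp (-(ξ * v)) * fbmCov H u v

open Filter Topology in
theorem tendsto_truncatedVariance {ξ H : ℝ} (hξ : 0 < ξ) (hH : 0 < H) :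
    Tendsto (fun N : ℕ => truncatedVariance ξ H N) atTop
      (𝓝 (H * Real.Gamma (2 * H) * ξ ^ (-(2 * H)))) := by
  rw [← integral_fbmCov_kernel hξ hH]
  refine Tendsto.const_mul _ ?_
  have hint := integrable_fbmCov_kernel hξ hH
  rw [Measure.prod_restrict] at hint ⊢
  set S : ℕ → Set (ℝ × ℝ) := fun N => Ioc 0 (N : ℝ) ×ˢ Ioc 0 (N : ℝ) with hS
  have hmono : Monotone S := fun m n hmn => by
    have : (m : ℝ) ≤ n := by exact_mod_cast hmn
    exact prod_mono (Ioc_subset_Ioc_right this) (Ioc_subset_Ioc_right this)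
  have hU : ⋃ N, S N = Ioi (0 : ℝ) ×ˢ Ioi (0 : ℝ) := by
    ext ⟨u, v⟩
    simp only [hS, mem_iUnion, mem_prod, mem_Ioc, mem_Ioi]
    constructor
    · rintro ⟨N, h1, h2⟩
      exact ⟨h1.1, h2.1⟩
    · rintro ⟨h1, h2⟩
      obtain ⟨N, hN⟩ := exists_nat_ge (max u v)
      exact ⟨N, ⟨h1, (le_max_left _ _).trans hN⟩, ⟨h2, (le_max_right _ _).trans hN⟩⟩
  have hlim := tendsto_setIntegral_of_monotone
    (fun N => measurableSet_Ioc.prod measurableSet_Ioc) hmono (by rw [hU]; exact hint)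
  rw [hU] at hlim
  refine hlim.congr fun N => ?_
  have hsub : IntegrableOn (fun z : ℝ × ℝ =>
      Real.exp (-(ξ * z.1)) * Real.exp (-(ξ * z.2)) * fbmCov H z.1 z.2) (S N)
      (volume.prod volume) := by
    refine IntegrableOn.mono_set hint ?_
    rw [← hU]
    exact subset_iUnion S N
  rw [setIntegral_prod _ hsub, intervalIntegral.integral_of_le (Nat.cast_nonneg N)]
  simp_rw [intervalIntegral.integral_of_le (Nat.cast_nonneg (α := ℝ) N)]

/-! ### The Gaussian integral driving the equation -/

section Driving

variable {Ω : Type*} {B : ℝ≥0 → Ω → ℝ}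

/-- The backward increment `B T - B (T - u)`. -/
def backwardIncrement (B : ℝ≥0 → Ω → ℝ) (T u : ℝ) (ω : Ω) : ℝ :=
  B T.toNNReal ω - B (T - u).toNNReal ω

/-- The Riemann sum of `∫ u in 0..T, exp (-(ξ * u)) * (B T - B (T - u))`. -/
noncomputable def riemannSum (B : ℝ≥0 → Ω → ℝ) (ξ T : ℝ) (n : ℕ) (ω : Ω) : ℝ :=
  (∑ k ∈ Finset.range n, T * (Real.exp (-(ξ * (T * (k / n)))) *
    backwardIncrement B T (T * (k / n)) ω)) / n

theorem riemannSum_eq (B : ℝ≥0 → Ω → ℝ) (ξ T : ℝ) (n : ℕ) :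
    riemannSum B ξ T n = fun ω => ∑ k ∈ Finset.range n,
      (T * Real.exp (-(ξ * (T * (k / n)))) / n) * backwardIncrement B T (T * (k / n)) ω := by
  ext ω
  rw [riemannSum, Finset.sum_div]
  exact Finset.sum_congr rfl fun k _ => by ring

open Filter Topology in
theorem tendsto_riemannSum (ξ T : ℝ) {ω : Ω} (hω : Continuous fun t => B t ω) :
    Tendsto (fun n => riemannSum B ξ T n ω) atTop
      (𝓝 (∫ u in (0 : ℝ)..T, Real.exp (-(ξ * u)) * backwardIncrement B T u ω)) := by
  have hc : Continuous fun u => Real.exp (-(ξ * u)) * backwardIncrement B T u ω := by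
    have : Continuous fun u : ℝ => B (T - u).toNNReal ω :=
      hω.comp (continuous_real_toNNReal.comp (by fun_prop))
    unfold backwardIncrement
    fun_prop
  have h := tendsto_sum_div
    (fun x => T * (Real.exp (-(ξ * (T * x))) * backwardIncrement B T (T * x) ω))
    (continuous_const.mul (hc.comp (continuous_const_mul T)))
  have e := intervalIntegral.smul_integral_comp_mul_left (a := 0) (b := 1)
    (fun u => Real.exp (-(ξ * u)) * backwardIncrement B T u ω) T
  rw [mul_zero, mul_one, smul_eq_mul] at e
  rw [intervalIntegral.integral_const_mul, e] at h
  exact h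

variable [MeasurableSpace Ω] {P : Measure Ω} {H : ℝ}

theorem ProbabilityTheory.IsGaussianProcess.backwardIncrement (hB : IsGaussianProcess B P) (T : ℝ) :
    IsGaussianProcess (backwardIncrement B T) P := by
  classical
  refine hB.of_isGaussianProcess fun u => ⟨{T.toNNReal, (T - u).toNNReal},
    ContinuousLinearMap.proj (R := ℝ) ⟨T.toNNReal, by simp⟩ -
      ContinuousLinearMap.proj (R := ℝ) ⟨(T - u).toNNReal, by simp⟩, fun ω => rfl⟩

theorem IsFractionalBrownianMotion.integral_backwardIncrement
    (hB : IsFractionalBrownianMotion H B P) (T u : ℝ) :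
    ∫ ω, backwardIncrement B T u ω ∂P = 0 := by
  unfold backwardIncrement
  rw [integral_sub (hB.isGaussianProcess.hasGaussianLaw_eval _).integrable
    (hB.isGaussianProcess.hasGaussianLaw_eval _).integrable, hB.integral_eq_zero,
    hB.integral_eq_zero, sub_zero]

/-- Reversing time from `T` again gives the covariance of fractional Brownian motion. As `T` drops
out, the variances for different horizons integrate one fixed kernel. -/
theorem IsFractionalBrownianMotion.covariance_backwardIncrement [IsProbabilityMeasure P]
    (hB : IsFractionalBrownianMotion H B P) (hH : 0 < H) {T u v : ℝ} (hT : 0 ≤ T)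
    (hu : u ≤ T) (hv : v ≤ T) (hu0 : 0 ≤ u) (hv0 : 0 ≤ v) :
    cov[backwardIncrement B T u, backwardIncrement B T v; P] = fbmCov H u v := by
  have hm : ∀ s, MemLp (B s) 2 P := fun s =>
    (hB.isGaussianProcess.hasGaussianLaw_eval s).memLp_two
  have e : ∀ u, backwardIncrement B T u = B T.toNNReal - B (T - u).toNNReal := fun u => rfl
  rw [e, e, covariance_sub_left (hm _) (hm _) ((hm _).sub (hm _)),
    covariance_sub_right (hm _) (hm _) (hm _), covariance_sub_right (hm _) (hm _) (hm _)]
  simp only [hB.covariance_eq, Real.coe_toNNReal _ hT, Real.coe_toNNReal _ (sub_nonneg.2 hu),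
    Real.coe_toNNReal _ (sub_nonneg.2 hv)]
  have h2 : 2 * H ≠ 0 := by positivity
  rw [sub_self, abs_zero, Real.zero_rpow h2, sub_sub_cancel, abs_of_nonneg hv0,
    sub_sub_cancel_left, abs_neg, abs_of_nonneg hu0, sub_sub_sub_cancel_left, abs_sub_comm v u,
    fbmCov]
  ring

theorem charFun_map_of_integral_eq_zero {X : Ω → ℝ} (hX : HasGaussianLaw X P)
    (h0 : ∫ ω, X ω ∂P = 0) (c : ℝ) :
    ∫ ω, Complex.exp (((c * X ω : ℝ) : ℂ) * Complex.I) ∂P =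
      (Real.exp (-(c ^ 2 * Var[X; P] / 2)) : ℝ) := by
  have h1 : charFun (P.map X) c = ∫ ω, Complex.exp (((c * X ω : ℝ) : ℂ) * Complex.I) ∂P := by
    rw [charFun_apply_real, integral_map hX.aemeasurable (by fun_prop)]
    push_cast
    rfl
  rw [← h1, hX.map_eq_gaussianReal, charFun_gaussianReal, h0]
  simp only [Complex.ofReal_zero, mul_zero, zero_mul, zero_sub,
    Real.coe_toNNReal _ (variance_nonneg X P)]
  push_cast
  congr 1
  ring

theorem IsFractionalBrownianMotion.hasGaussianLaw_riemannSum
    (hB : IsFractionalBrownianMotion H B P) (ξ T : ℝ) (n : ℕ) :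
    HasGaussianLaw (riemannSum B ξ T n) P := by
  have h1 : IsGaussianProcess (fun k : ℕ => backwardIncrement B T (T * (k / n))) P :=
    (hB.isGaussianProcess.backwardIncrement T).comp_right fun k : ℕ => T * ((k : ℝ) / n)
  have h2 := (h1.smul fun k : ℕ => T * Real.exp (-(ξ * (T * (k / n)))) / n).hasGaussianLaw_fun_sum
    (I := Finset.range n)
  rw [riemannSum_eq]
  exact h2

theorem IsFractionalBrownianMotion.integral_riemannSum
    (hB : IsFractionalBrownianMotion H B P) (ξ T : ℝ) (n : ℕ) :
    ∫ ω, riemannSum B ξ T n ω ∂P = 0 := by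
  rw [riemannSum_eq, integral_finsetSum]
  · refine Finset.sum_eq_zero fun k _ => ?_
    rw [integral_const_mul, hB.integral_backwardIncrement, mul_zero]
  · exact fun k _ => ((hB.isGaussianProcess.backwardIncrement T).hasGaussianLaw_eval
      _).integrable.const_mul _

theorem IsFractionalBrownianMotion.variance_riemannSum [IsProbabilityMeasure P]
    (hB : IsFractionalBrownianMotion H B P) (hH : 0 < H) (ξ : ℝ) {T : ℝ} (hT : 0 ≤ T) (n : ℕ) :
    Var[riemannSum B ξ T n; P] = (∑ k ∈ Finset.range n, (∑ l ∈ Finset.range n,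
      T * (T * (Real.exp (-(ξ * (T * (k / n)))) * Real.exp (-(ξ * (T * (l / n)))) *
        fbmCov H (T * (k / n)) (T * (l / n))))) / n) / n := by
  have hmem : ∀ k ∈ Finset.range n, T * ((k : ℝ) / n) ≤ T ∧ 0 ≤ T * ((k : ℝ) / n) := by
    intro k hk
    have hkn : (k : ℝ) ≤ n := by exact_mod_cast (Finset.mem_range.1 hk).le
    exact ⟨mul_le_of_le_one_right hT (div_le_one_of_le₀ hkn (Nat.cast_nonneg n)), by positivity⟩
  rw [riemannSum_eq, variance_fun_sum', Finset.sum_div]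
  · refine Finset.sum_congr rfl fun k hk => ?_
    rw [Finset.sum_div, Finset.sum_div]
    refine Finset.sum_congr rfl fun l hl => ?_
    rw [covariance_const_mul_left, covariance_const_mul_right,
      hB.covariance_backwardIncrement hH hT (hmem k hk).1 (hmem l hl).1 (hmem k hk).2 (hmem l hl).2]
    ring
  · exact fun k _ => ((hB.isGaussianProcess.backwardIncrement T).hasGaussianLaw_eval
      _).memLp_two.const_mul _

open Filter Topology in
theorem IsFractionalBrownianMotion.tendsto_variance_riemannSum [IsProbabilityMeasure P]
    (hB : IsFractionalBrownianMotion H B P) (hH : 0 < H) (ξ : ℝ) {T : ℝ} (hT : 0 ≤ T) :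
    Tendsto (fun n => Var[riemannSum B ξ T n; P]) atTop
      (𝓝 (∫ u in (0 : ℝ)..T, ∫ v in (0 : ℝ)..T,
        Real.exp (-(ξ * u)) * Real.exp (-(ξ * v)) * fbmCov H u v)) := by
  simp_rw [hB.variance_riemannSum hH ξ hT]
  have hK : Continuous fun z : ℝ × ℝ => fbmCov H (T * z.1) (T * z.2) :=
    (continuous_fbmCov hH).comp (by fun_prop : Continuous fun z : ℝ × ℝ => (T * z.1, T * z.2))
  have h := tendsto_sum_sum_div (fun x y => T * (T * (Real.exp (-(ξ * (T * x))) *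
    Real.exp (-(ξ * (T * y))) * fbmCov H (T * x) (T * y)))) (by
      unfold Function.uncurry
      fun_prop)
  have e1 : ∀ x, ∫ y in (0 : ℝ)..1, T * (T * (Real.exp (-(ξ * (T * x))) *
      Real.exp (-(ξ * (T * y))) * fbmCov H (T * x) (T * y))) =
      T * ∫ v in (0 : ℝ)..T, Real.exp (-(ξ * (T * x))) * Real.exp (-(ξ * v)) *
        fbmCov H (T * x) v := fun x => by
    have e := intervalIntegral.smul_integral_comp_mul_left (a := 0) (b := 1)
      (fun v => Real.exp (-(ξ * (T * x))) * Real.exp (-(ξ * v)) * fbmCov H (T * x) v) T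
    rw [mul_zero, mul_one, smul_eq_mul] at e
    rw [intervalIntegral.integral_const_mul, intervalIntegral.integral_const_mul, e]
  have e2 := intervalIntegral.smul_integral_comp_mul_left (a := 0) (b := 1)
    (fun u => ∫ v in (0 : ℝ)..T, Real.exp (-(ξ * u)) * Real.exp (-(ξ * v)) * fbmCov H u v) T
  rw [mul_zero, mul_one, smul_eq_mul] at e2
  simp_rw [e1] at h
  rw [intervalIntegral.integral_const_mul, e2] at h
  exact h

-- The Riemann sums converge along almost every path and the exponentials are bounded, so
-- characteristic functions pass to the limit together with the variances.
open Filter Topology in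
theorem IsFractionalBrownianMotion.integral_exp_driving [IsProbabilityMeasure P]
    (hB : IsFractionalBrownianMotion H B P) (hH : 0 < H) (ξ : ℝ) {T : ℝ} (hT : 0 ≤ T) (c : ℝ) :
    ∫ ω, Complex.exp (((c * ∫ u in (0 : ℝ)..T, Real.exp (-(ξ * u)) * backwardIncrement B T u ω :
        ℝ) : ℂ) * Complex.I) ∂P =
      (Real.exp (-(c ^ 2 * (∫ u in (0 : ℝ)..T, ∫ v in (0 : ℝ)..T,
        Real.exp (-(ξ * u)) * Real.exp (-(ξ * v)) * fbmCov H u v) / 2)) : ℝ) := by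
  have hlim : Tendsto (fun n => ∫ ω, Complex.exp (((c * riemannSum B ξ T n ω : ℝ) : ℂ) *
      Complex.I) ∂P) atTop (𝓝 (∫ ω, Complex.exp (((c * ∫ u in (0 : ℝ)..T,
        Real.exp (-(ξ * u)) * backwardIncrement B T u ω : ℝ) : ℂ) * Complex.I) ∂P)) := by
    refine tendsto_integral_of_dominated_convergence (fun _ => 1) (fun n => ?_)
      (integrable_const _) (fun n => Eventually.of_forall fun ω => ?_) ?_
    · have := (hB.hasGaussianLaw_riemannSum ξ T n).aemeasurable
      exact (by fun_prop : AEMeasurable _ P).aestronglyMeasurable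
    · rw [Complex.norm_exp_ofReal_mul_I]
    · filter_upwards [hB.continuous_paths] with ω hω
      have hc : Continuous fun x : ℝ => Complex.exp (((c * x : ℝ) : ℂ) * Complex.I) := by fun_prop
      exact (hc.tendsto _).comp (tendsto_riemannSum ξ T hω)
  refine tendsto_nhds_unique hlim ?_
  simp_rw [charFun_map_of_integral_eq_zero (hB.hasGaussianLaw_riemannSum ξ T _)
    (hB.integral_riemannSum ξ T _) c]
  have hc : Continuous fun x : ℝ => ((Real.exp (-(c ^ 2 * x / 2)) : ℝ) : ℂ) := by fun_prop
  exact (hc.tendsto _).comp (hB.tendsto_variance_riemannSum hH ξ hT)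

theorem IsFractionalBrownianMotion.integral_sq [IsProbabilityMeasure P]
    (hB : IsFractionalBrownianMotion H B P) (hH : 0 < H) (t : ℝ≥0) :
    ∫ ω, B t ω ^ 2 ∂P = (t : ℝ) ^ (2 * H) := by
  have hm := (hB.isGaussianProcess.hasGaussianLaw_eval t).aemeasurable
  have h := hB.covariance_eq t t
  have h2 : 2 * H ≠ 0 := by positivity
  rw [covariance_self hm, variance_of_integral_eq_zero hm (hB.integral_eq_zero t), sub_self,
    abs_zero, Real.zero_rpow h2] at h
  rw [h]
  ring

/-- A crude bound from `|x| ≤ 1 + x²`; polynomial growth is all that the factor `exp (-ξt)`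
requires. -/
theorem IsFractionalBrownianMotion.integral_abs_le [IsProbabilityMeasure P]
    (hB : IsFractionalBrownianMotion H B P) (hH : 0 < H) (t : ℝ≥0) :
    Integrable (B t) P ∧ ∫ ω, |B t ω| ∂P ≤ 1 + (t : ℝ) ^ (2 * H) := by
  have hg := hB.isGaussianProcess.hasGaussianLaw_eval t
  refine ⟨hg.integrable, ?_⟩
  have hsq : Integrable (fun ω => B t ω ^ 2) P := hg.memLp_two.integrable_sq
  calc ∫ ω, |B t ω| ∂P ≤ ∫ ω, (1 + B t ω ^ 2) ∂P := by
        refine integral_mono hg.integrable.abs ((integrable_const _).add hsq) fun ω => ?_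
        have := sq_abs (B t ω)
        simp only
        nlinarith [sq_nonneg (|B t ω| - 1), sq_nonneg (|B t ω|)]
    _ = 1 + (t : ℝ) ^ (2 * H) := by
        rw [integral_add (integrable_const _) hsq, hB.integral_sq hH]
        simp

end Driving

/-! ### The stationary law -/

theorem norm_exp_mul_I_sub_one_le (x : ℝ) : ‖Complex.exp ((x : ℂ) * Complex.I) - 1‖ ≤ |x| := by
  rw [mul_comm]
  exact Real.norm_exp_I_mul_ofReal_sub_one_le

/-- The two perturbations are treated differently: `x` will carry `U 0`, of which no moment is
assumed, and `y` will carry the integrable `B t`. -/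
theorem norm_exp_mul_I_add_add_sub_le (x y z : ℝ) :
    ‖Complex.exp (((x + y + z : ℝ) : ℂ) * Complex.I) - Complex.exp ((z : ℂ) * Complex.I)‖ ≤
      ‖Complex.exp ((x : ℂ) * Complex.I) - 1‖ + |y| := by
  have h : Complex.exp (((x + y + z : ℝ) : ℂ) * Complex.I) - Complex.exp ((z : ℂ) * Complex.I) =
      ((Complex.exp ((x : ℂ) * Complex.I) - 1) * Complex.exp ((y : ℂ) * Complex.I) +
        (Complex.exp ((y : ℂ) * Complex.I) - 1)) * Complex.exp ((z : ℂ) * Complex.I) := by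
    push_cast
    rw [add_mul, add_mul, Complex.exp_add, Complex.exp_add]
    ring
  rw [h, norm_mul, Complex.norm_exp_ofReal_mul_I, mul_one]
  refine (norm_add_le _ _).trans (add_le_add ?_ (norm_exp_mul_I_sub_one_le y))
  rw [norm_mul, Complex.norm_exp_ofReal_mul_I, mul_one]

theorem IsStationaryProcess.identDistrib_zero {Ω : Type*} [MeasurableSpace Ω] {P : Measure Ω}
    {U : ℝ≥0 → Ω → ℝ} (hU : IsStationaryProcess U P) (t : ℝ≥0) :
    IdentDistrib (U t) (U 0) P P := by
  have h := (hU t {0}).comp (measurable_pi_apply (⟨0, by simp⟩ : ({0} : Finset ℝ≥0)))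
  simpa [Function.comp_def] using h

theorem IsFractionalOU.ae_eq_driving {Ω : Type*} [MeasurableSpace Ω] {P : Measure Ω} {ξ σ H : ℝ}
    {B U : ℝ≥0 → Ω → ℝ} (hB : IsFractionalBrownianMotion H B P) (hU : IsFractionalOU ξ σ B U P)
    {t : ℝ} (ht : 0 ≤ t) :
    ∀ᵐ ω ∂P, U t.toNNReal ω = Real.exp (-(ξ * t)) * (U 0 ω + σ * B t.toNNReal ω) +
      σ * ξ * ∫ u in (0 : ℝ)..t, Real.exp (-(ξ * u)) * backwardIncrement B t u ω := by
  filter_upwards [hB.continuous_paths, hU.continuous_paths, hU.equation] with ω h1 h2 h3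
  have := linear_equation_solution (ξ := ξ) (σ := σ) (y := fun s => U s.toNNReal ω)
    (b := fun s => B s.toNNReal ω) (h2.comp continuous_real_toNNReal)
    (h1.comp continuous_real_toNNReal) (fun s hs => by
      have := h3 s.toNNReal
      rw [Real.coe_toNNReal _ hs] at this
      simpa only [Real.toNNReal_zero] using this) ht
  simpa only [Real.toNNReal_zero, backwardIncrement] using this

open Filter Topology in
theorem charFun_of_isStationaryLawFOU {ξ σ H : ℝ} (hξ : 0 < ξ) (hH : 0 < H) {μ : Measure ℝ}
    (hμ : IsStationaryLawFOU ξ σ H μ) (χ : ℝ) :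
    charFun μ χ =
      (Real.exp (-(σ ^ 2 * (H * Real.Gamma (2 * H) * ξ ^ (-(2 * H))) * χ ^ 2 / 2)) : ℝ) := by
  obtain ⟨Ω, _, P, B, U, hP, hB, hU, hS, rfl⟩ := hμ
  have hid := fun t => hS.identDistrib_zero t
  have hUm : ∀ t, AEMeasurable (U t) P := fun t => (hid t).aemeasurable_fst
  have hBm : ∀ t, AEMeasurable (B t) P := fun t => hB.isGaussianProcess.aemeasurable t
  set J : ℕ → Ω → ℝ := fun N ω =>
    ∫ u in (0 : ℝ)..N, Real.exp (-(ξ * u)) * backwardIncrement B N u ω with hJ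
  set D : ℕ → ℂ := fun N => ∫ ω, Complex.exp (((χ * σ * ξ * J N ω : ℝ) : ℂ) * Complex.I) ∂P with hD
  have hDlim : Tendsto D atTop (𝓝
      (Real.exp (-(σ ^ 2 * (H * Real.Gamma (2 * H) * ξ ^ (-(2 * H))) * χ ^ 2 / 2)) : ℝ)) := by
    have hc : Continuous fun x : ℝ => ((Real.exp (-(σ ^ 2 * x * χ ^ 2 / 2)) : ℝ) : ℂ) := by
      fun_prop
    refine ((hc.tendsto _).comp (tendsto_truncatedVariance hξ hH)).congr fun N => ?_
    simp only [hD, hJ, Function.comp_apply]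
    rw [hB.integral_exp_driving hH ξ (Nat.cast_nonneg N), truncatedVariance]
    congr 3
    ring
  set r : ℕ → ℝ := fun N => Real.exp (-(ξ * N)) with hr
  set E : ℕ → ℝ := fun N => ∫ ω, ‖Complex.exp (((χ * r N * U 0 ω : ℝ) : ℂ) * Complex.I) - 1‖ ∂P
    with hE
  have hrlim : Tendsto r atTop (𝓝 0) := by
    refine Real.tendsto_exp_neg_atTop_nhds_zero.comp ?_
    exact tendsto_natCast_atTop_atTop.const_mul_atTop hξ
  have hElim : Tendsto E atTop (𝓝 0) := by
    have h0 : (0 : ℝ) = ∫ _, (0 : ℝ) ∂P := by simp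
    rw [h0]
    refine tendsto_integral_of_dominated_convergence (fun _ => 2) (fun N => ?_)
      (integrable_const _) (fun N => Eventually.of_forall fun ω => ?_)
      (Eventually.of_forall fun ω => ?_)
    · have := hUm 0
      exact (by fun_prop : AEMeasurable _ P).aestronglyMeasurable
    · rw [norm_norm]
      refine (norm_sub_le _ _).trans ?_
      rw [Complex.norm_exp_ofReal_mul_I, norm_one]
      norm_num
    · have hc : Continuous fun x : ℝ =>
          ‖Complex.exp (((χ * x * U 0 ω : ℝ) : ℂ) * Complex.I) - 1‖ := by fun_prop
      simpa [Function.comp_def] using (hc.tendsto 0).comp hrlim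
  set A : ℕ → ℝ := fun N => |χ * σ| * (r N * (1 + (N : ℝ) ^ (2 * H))) with hA
  have hAlim : Tendsto A atTop (𝓝 0) := by
    have h1 : Tendsto (fun N : ℕ => (N : ℝ) ^ (2 * H) * r N) atTop (𝓝 0) := by
      simpa only [neg_mul, Function.comp_def] using (tendsto_rpow_mul_exp_neg_mul_atTop_nhds_zero (2 * H) ξ hξ).comp
        tendsto_natCast_atTop_atTop
    have h2 := (hrlim.add h1).const_mul |χ * σ|
    rw [add_zero, mul_zero] at h2
    refine h2.congr fun N => ?_
    simp only [hA]
    ring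
  have hbound : ∀ N : ℕ, ‖D N - charFun (P.map (U 0)) χ‖ ≤ E N + A N := by
    intro N
    have hsol : ∀ᵐ ω ∂P, U N ω = r N * (U 0 ω + σ * B N ω) + σ * ξ * J N ω := by
      simpa only [Real.toNNReal_natCast] using hU.ae_eq_driving hB (Nat.cast_nonneg N)
    have hexp : ∀ X : Ω → ℝ, AEMeasurable X P →
        Integrable (fun ω => Complex.exp (((X ω : ℝ) : ℂ) * Complex.I)) P := fun X hX => by
      refine Integrable.of_bound (C := 1)
        (by fun_prop : AEMeasurable _ P).aestronglyMeasurable (Eventually.of_forall fun ω => ?_)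
      rw [Complex.norm_exp_ofReal_mul_I]
    -- Measurability of the pathwise integral is read off from the solution formula, whose other
    -- terms are measurable.
    have hJm : AEMeasurable (fun ω => χ * σ * ξ * J N ω) P := by
      have h0 := hUm 0
      have h1 := hUm N
      have h2 := hBm N
      have : AEMeasurable (fun ω => χ * (U N ω - r N * (U 0 ω + σ * B N ω))) P := by fun_prop
      refine this.congr ?_
      filter_upwards [hsol] with ω hω
      rw [hω]
      ring
    have hchar : charFun (P.map (U 0)) χ =
        ∫ ω, Complex.exp (((χ * U N ω : ℝ) : ℂ) * Complex.I) ∂P := by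
      rw [← (hid N).map_eq, charFun_apply_real, integral_map (hUm N) (by fun_prop)]
      push_cast
      rfl
    obtain ⟨hBi, hBle⟩ := hB.integral_abs_le hH (N : ℝ≥0)
    have hEi : Integrable
        (fun ω => ‖Complex.exp (((χ * r N * U 0 ω : ℝ) : ℂ) * Complex.I) - 1‖) P :=
      ((hexp _ ((hUm 0).const_mul _)).sub (integrable_const _)).norm
    have hAi : Integrable (fun ω => |χ * σ| * (r N * |B N ω|)) P :=
      (hBi.abs.const_mul _).const_mul _
    rw [norm_sub_rev, hchar, hD, ← integral_sub (hexp _ ((hUm N).const_mul χ)) (hexp _ hJm)]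
    calc ‖∫ ω, (Complex.exp (((χ * U N ω : ℝ) : ℂ) * Complex.I) -
          Complex.exp (((χ * σ * ξ * J N ω : ℝ) : ℂ) * Complex.I)) ∂P‖
        ≤ ∫ ω, (‖Complex.exp (((χ * r N * U 0 ω : ℝ) : ℂ) * Complex.I) - 1‖ +
            |χ * σ| * (r N * |B N ω|)) ∂P := by
          refine norm_integral_le_of_norm_le (hEi.add hAi) ?_
          filter_upwards [hsol] with ω hω
          have h := norm_exp_mul_I_add_add_sub_le (χ * r N * U 0 ω) (χ * σ * (r N * B N ω))
            (χ * σ * ξ * J N ω)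
          rw [abs_mul (χ * σ), abs_mul (r N), abs_of_pos (Real.exp_pos _ : 0 < r N)] at h
          have e : χ * U N ω = χ * r N * U 0 ω + χ * σ * (r N * B N ω) + χ * σ * ξ * J N ω := by
            rw [hω]
            ring
          rw [e]
          exact h
      _ ≤ E N + A N := by
          rw [integral_add hEi hAi, integral_const_mul, integral_const_mul]
          simp only [hA]
          have : 0 ≤ r N := (Real.exp_pos _).le
          push_cast at hBle
          gcongr
  have hDlim' : Tendsto D atTop (𝓝 (charFun (P.map (U 0)) χ)) := by
    rw [tendsto_iff_norm_sub_tendsto_zero]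
    refine squeeze_zero (fun _ => norm_nonneg _) hbound ?_
    simpa using hElim.add hAlim
  exact tendsto_nhds_unique hDlim' hDlim

theorem mainTheorem7
    (mξ Mξ mσ Mσ mH MH : ℝ)
    (hmξ : 0 < mξ) (hξ : mξ < Mξ)
    (hmσ : 0 < mσ) (hσ : mσ < Mσ)
    (hmH : 0 < mH) (hH : mH < MH) (hMH : MH < 1)
    (p : ℝ) (hp : 1 ≤ p) :
    -- the unknown parameter is the drift `ξ`
    (∀ σ ∈ Icc mσ Mσ, ∀ H ∈ Icc mH MH,
      LowerLipschitzCF p mξ Mξ (fun ξ => IsStationaryLawFOU ξ σ H) ∧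
      StronglyIdentifiableCF p mξ Mξ (fun ξ => IsStationaryLawFOU ξ σ H)) ∧
    -- the unknown parameter is the diffusion coefficient `σ`
    (∀ ξ ∈ Icc mξ Mξ, ∀ H ∈ Icc mH MH,
      LowerLipschitzCF p mσ Mσ (fun σ => IsStationaryLawFOU ξ σ H) ∧
      StronglyIdentifiableCF p mσ Mσ (fun σ => IsStationaryLawFOU ξ σ H)) ∧
    -- the unknown parameter is the Hurst parameter `H`
    (∀ ξ ∈ Icc mξ Mξ, ∀ σ ∈ Icc mσ Mσ,
      (sSup (hurstThreshold '' Icc mH MH) < ξ ∨ ξ < sInf (hurstThreshold '' Icc mH MH)) →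
      LowerLipschitzCF p mH MH (fun H => IsStationaryLawFOU ξ σ H) ∧
      StronglyIdentifiableCF p mH MH (fun H => IsStationaryLawFOU ξ σ H)) := by
  refine ⟨fun σ hσ' H hH' => ?_, fun ξ hξ' H hH' => ?_, fun ξ hξ' σ hσ' hthr => ?_⟩
  · have hσ0 : 0 < σ := hmσ.trans_le hσ'.1
    have hH0 : 0 < H := hmH.trans_le hH'.1
    refine identifiable_of_logVariance hp (L := fun ξ => logVarianceFOU ξ σ H)
      -- The slope `-2H/ξ` is weakest at the right end `Mξ`.
      (κ := 2 * H * Mξ⁻¹) (by have := hmξ.trans hξ; positivity) (fun ξ hξ' μ hμ χ => ?_)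
      (fun ξ hξ' => hasDerivAt_logVarianceFOU_drift (hmξ.trans_le hξ'.1))
      (Or.inr fun ξ hξ' => ?_)
    · rw [exp_logVarianceFOU (hmξ.trans_le hξ'.1) hσ0 hH0]
      exact charFun_of_isStationaryLawFOU (hmξ.trans_le hξ'.1) hH0 hμ χ
    · have := inv_anti₀ (hmξ.trans_le hξ'.1) hξ'.2
      exact neg_le_neg (mul_le_mul_of_nonneg_left this (by positivity))
  · have hξ0 : 0 < ξ := hmξ.trans_le hξ'.1
    have hH0 : 0 < H := hmH.trans_le hH'.1
    refine identifiable_of_logVariance hp (L := fun σ => logVarianceFOU ξ σ H)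
      (κ := 2 * Mσ⁻¹) (by have := hmσ.trans hσ; positivity) (fun σ hσ' μ hμ χ => ?_)
      (fun σ hσ' => hasDerivAt_logVarianceFOU_diffusion (hmσ.trans_le hσ'.1))
      (Or.inl fun σ hσ' => ?_)
    · rw [exp_logVarianceFOU hξ0 (hmσ.trans_le hσ'.1) hH0]
      exact charFun_of_isStationaryLawFOU hξ0 hH0 hμ χ
    · have := inv_anti₀ (hmσ.trans_le hσ'.1) hσ'.2
      exact mul_le_mul_of_nonneg_left this (by positivity)
  · have hξ0 : 0 < ξ := hmξ.trans_le hξ'.1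
    have hσ0 : 0 < σ := hmσ.trans_le hσ'.1
    obtain ⟨κ, hκ, hbound⟩ := exists_hurst_deriv_bound hmH hH.le hξ0 hthr
    refine identifiable_of_logVariance hp (L := fun H => logVarianceFOU ξ σ H) hκ
      (fun H hH' μ hμ χ => ?_)
      (fun H hH' => hasDerivAt_logVarianceFOU_hurst (hmH.trans_le hH'.1)) hbound
    rw [exp_logVarianceFOU hξ0 hσ0 (hmH.trans_le hH'.1)]
    exact charFun_of_isStationaryLawFOU hξ0 (hmH.trans_le hH'.1) hμ χ
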